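/- Let $g_1,\dots,g_s\in\mathbb Q[p_0,\dots,p_n]$ be homogeneous polynomials defining a nonempty, irreducible (irreducibility over $\mathbb Q$ suffices), generically reduced projective variety $X=\mathcal V(g_1,\dots,g_s)\subset\mathbb P^n$ of codimension $k$ over $\mathbb C$, and let $h_1,\dots,h_k\in\mathbb Q[p_0,\dots,p_n]$ be homogeneous polynomials such that $X$ is an irreducible component of $\mathcal V(h_1,\dots,h_k)$. In the indeterminates $\mathbf u=(u_0,\dots,u_n)$, $\mathbf p=(p_0,\dots,p_n)$, $\Lambda=(\lambda_1,\dots,\lambda_{k+1})$ put $$F_i=p_i\Big(\lambda_1+\frac{\partial h_1}{\partial p_i}\lambda_2+\cdots+\frac{\partial h_k}{\partial p_i}\lambda_{k+1}\Big)-u_i\quad(0\le i\le n),$$ $$F_{n+j}=g_j\quad(1\le j\le s),\qquad F_m=p_0+\cdots+p_n-1,\quad m=n+s+1,$$ and let $J$ be the determinant of the $(n+k+2)\times(n+k+2)$ matrix of partial derivatives of $F_0,\dots,F_n,\ p_0+\cdots+p_n-1,\ h_1,\dots,h_k$ with respect to $p_0,\dots,p_n,\lambda_1,\dots,\lambda_{k+1}$.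 Let $\mathcal L_X\subset\mathbb C^{n+1}\times\mathbb C^{n+1}\times\mathbb C^{k+1}$ be the common zero set of $F_0,\dots,F_m$, let $\pi$ be the projection to the $\mathbf u$-coordinates, and let $\mathcal L_{X,J}\subset\mathbb C^{n+1}$ be the Zariski closure (over $\mathbb Q$) of $\pi(\mathcal L_X\cap\{J=0\})$, which is a cone. Define $\mathcal D_{X_J}\in\mathbb Q[\mathbf u]$, up to a nonzero constant factor, as follows. If $\mathcal L_{X,J}$ has codimension $1$, then $\mathcal D_{X_J}=D_1\cdots D_K$, where the zero sets of $D_1,\dots,D_K\in\mathbb Q[\mathbf u]$ are the distinct codimension $1$ irreducible components (over $\mathbb Q$) of $\mathcal L_{X,J}$ and each ideal $\langle D_j\rangle$ is radical. If the codimension is greater than $1$, then $\mathcal D_{X_J}=1$. (If the codimension were $0$, put $\mathcal D_{X_J}=0$.) Then there is an affine variety $V\subsetneq\mathbb C^n$, defined by polynomials with rational coefficients, such that for every field $K$ with an embedding in $\mathbb C$ (in particular $K=\mathbb Q$ and $K=\mathbb C$) and all $(a_1,\dots,a_n)\in K^n$ whose image in $\mathbb C^n$ is not in $V$: if $F_i^*$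 denotes $F_i$ with $u_i$ replaced by $a_i$ ($1\le i\le n$), then $$\sqrt{\langle F_0,F_1^*,\dots,F_n^*,F_{n+1},\dots,F_m,J\rangle\cap K[u_0]}=\big\langle \mathcal D_{X_J}(u_0,a_1,\dots,a_n)\big\rangle\subset K[u_0],$$ where the ideal on the left, before intersecting, is taken in $K[u_0,\mathbf p,\Lambda]$. -/

import Mathlib

open MvPolynomial

namespace LikelihoodDiscriminant

/-- The ideal of `ℚ[p₀, …, pₙ]` of all polynomials vanishing on the common complex zeros of
the `g i`.  For homogeneous `g i` this is the homogeneous ideal of the projective variety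
`𝒱(g₁, …, gₛ) ⊆ ℙⁿ(ℂ)`. -/
noncomputable def varietyIdeal {n s : ℕ} (g : Fin s → MvPolynomial (Fin (n + 1)) ℚ) :
    Ideal (MvPolynomial (Fin (n + 1)) ℚ) :=
  vanishingIdeal ℚ (zeroLocus ℂ (Ideal.span (Set.range g)))

/-- `g₁, …, gₛ` are model invariants of an algebraic statistical model: homogeneous polynomials
with rational coefficients defining a (nonempty) irreducible, generically reduced projective
variety in `ℙⁿ`. -/
structure IsModel {n s : ℕ} (g : Fin s → MvPolynomial (Fin (n + 1)) ℚ) : Prop where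
  homogeneous : ∀ i, ∃ d : ℕ, (g i).IsHomogeneous d
  /-- The projective variety has a point. -/
  nonempty : ∃ x ∈ zeroLocus ℂ (Ideal.span (Set.range g)), x ≠ 0
  irreducible : (varietyIdeal g).IsPrime
  /-- The ideal generated by the `g i` agrees with the ideal of the variety locally at the
  generic point, that is, after inverting one polynomial not vanishing on the variety. -/
  genericallyReduced : ∃ f, f ∉ varietyIdeal g ∧
    ∀ q ∈ varietyIdeal g, f * q ∈ Ideal.span (Set.range g)

/-- `{h₁, …, hₖ}` is a set of general model invariants for the model defined by the `g i`:
`k` is the codimension of `𝒱(g₁, …, gₛ)`, the `h j` are homogeneous, and `𝒱(g₁, …, gₛ)` is an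
irreducible component of `𝒱(h₁, …, hₖ)`. -/
structure IsGeneralInvariants {n s k : ℕ} (g : Fin s → MvPolynomial (Fin (n + 1)) ℚ)
    (h : Fin k → MvPolynomial (Fin (n + 1)) ℚ) : Prop where
  codim : (varietyIdeal g).height = k
  homogeneous : ∀ j, ∃ d : ℕ, (h j).IsHomogeneous d
  component : varietyIdeal g ∈ (varietyIdeal h).minimalPrimes

/-- The unknowns `p₀, …, pₙ, λ₁, …, λₖ₊₁`; the multiplier `λⱼ₊₁` has index `j : Fin (k + 1)`. -/
abbrev Unknown (n k : ℕ) : Type := Fin (n + 1) ⊕ Fin (k + 1)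

/-- All the indeterminates: the parameters `u₀, …, uₙ`, then the unknowns. -/
abbrev Var (n k : ℕ) : Type := Fin (n + 1) ⊕ Unknown n k

/-- The indeterminate `uᵢ`. -/
noncomputable def u {n k : ℕ} (i : Fin (n + 1)) : MvPolynomial (Var n k) ℚ := X (Sum.inl i)

/-- The indeterminate `pᵢ`. -/
noncomputable def p {n k : ℕ} (i : Fin (n + 1)) : MvPolynomial (Var n k) ℚ :=
  X (Sum.inr (Sum.inl i))

/-- The indeterminate `λⱼ₊₁`. -/
noncomputable def lam {n k : ℕ} (j : Fin (k + 1)) : MvPolynomial (Var n k) ℚ :=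
  X (Sum.inr (Sum.inr j))

/-- A polynomial in `p₀, …, pₙ` as a polynomial in all the indeterminates. -/
noncomputable def inP {n k : ℕ} (f : MvPolynomial (Fin (n + 1)) ℚ) : MvPolynomial (Var n k) ℚ :=
  rename (fun i => Sum.inr (Sum.inl i)) f

/-- `Fᵢ = pᵢ (λ₁ + ∂h₁/∂pᵢ λ₂ + ⋯ + ∂hₖ/∂pᵢ λₖ₊₁) - uᵢ` for `i = 0, …, n`. -/
noncomputable def lagrangeF {n k : ℕ} (h : Fin k → MvPolynomial (Fin (n + 1)) ℚ)
    (i : Fin (n + 1)) : MvPolynomial (Var n k) ℚ :=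
  p i * (lam 0 + ∑ j : Fin k, inP (pderiv i (h j)) * lam j.succ) - u i

/-- `p₀ + ⋯ + pₙ - 1`. -/
noncomputable def sumEq (n k : ℕ) : MvPolynomial (Var n k) ℚ := (∑ i, p i) - 1

/-- The set `{F₀, …, Fₙ, g₁, …, gₛ, p₀ + ⋯ + pₙ - 1}` of the Lagrange likelihood equations. -/
def likelihoodEqs {n s k : ℕ} (g : Fin s → MvPolynomial (Fin (n + 1)) ℚ)
    (h : Fin k → MvPolynomial (Fin (n + 1)) ℚ) : Set (MvPolynomial (Var n k) ℚ) :=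
  Set.range (lagrangeF h) ∪ Set.range (fun i => inP (g i)) ∪ {sumEq n k}

/-- The determinant `J` of the matrix whose rows hold the partial derivatives with respect to
the unknowns of `F₀, …, Fₙ, p₀ + ⋯ + pₙ - 1, h₁, …, hₖ`, in this order. -/
noncomputable def jacobianJ {n k : ℕ} (h : Fin k → MvPolynomial (Fin (n + 1)) ℚ) :
    MvPolynomial (Var n k) ℚ :=
  Matrix.det (Matrix.of fun r c : Unknown n k =>
    pderiv (Sum.inr c)
      (Sum.elim (lagrangeF h) (Fin.cons (sumEq n k) (fun j : Fin k => inP (h j))) r))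

/-- The Lagrange likelihood correspondence `ℒ_X ⊆ ℂⁿ⁺¹ × ℂⁿ⁺¹ × ℂᵏ⁺¹`. -/
def correspondence {n s k : ℕ} (g : Fin s → MvPolynomial (Fin (n + 1)) ℚ)
    (h : Fin k → MvPolynomial (Fin (n + 1)) ℚ) : Set (Var n k → ℂ) :=
  zeroLocus ℂ (Ideal.span (likelihoodEqs g h))

/-- The projection to the space of the parameters `u`. -/
def proj {n k : ℕ} (v : Var n k → ℂ) : Fin (n + 1) → ℂ := fun i => v (Sum.inl i)

/-- `𝓘(π(ℒ_X ∩ 𝒱ₐ(J))) ⊆ ℚ[u]`, the ideal of `ℒ_{X,J}`. -/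
noncomputable def idealLJ {n s k : ℕ} (g : Fin s → MvPolynomial (Fin (n + 1)) ℚ)
    (h : Fin k → MvPolynomial (Fin (n + 1)) ℚ) : Ideal (MvPolynomial (Fin (n + 1)) ℚ) :=
  vanishingIdeal ℚ (proj '' (correspondence g h ∩ zeroLocus ℂ (Ideal.span {jacobianJ h})))

/-- The codimension 1 irreducible components of `ℒ_{X,J} = 𝒱ₐ(𝓘(π(ℒ_X ∩ 𝒱ₐ(J)))) ⊆ ℂⁿ⁺¹`, in the
Zariski topology given by polynomials with rational coefficients.  As `ℒ_{X,J}` is a cone, these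
are the cones over the codimension 1 irreducible components of `ℒ_{X,J} \ {0}` in `ℙⁿ`. -/
def codimOneComponents {n s k : ℕ} (g : Fin s → MvPolynomial (Fin (n + 1)) ℚ)
    (h : Fin k → MvPolynomial (Fin (n + 1)) ℚ) : Set (Set (Fin (n + 1) → ℂ)) :=
  {Z | ∃ P ∈ (idealLJ g h).minimalPrimes, P.height = 1 ∧ Z = zeroLocus ℂ P}

/-- `D` is the polynomial `𝒟_{X,J}` (which is determined up to a nonzero constant factor):

* if `ℒ_{X,J}` has codimension 1, then `D = D₁ ⋯ D_K`, where the `𝒱(Dⱼ)` are the distinct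
  codimension 1 irreducible components of `ℒ_{X,J}` and the ideals `⟨Dⱼ⟩ ⊆ ℚ[u]` are radical;
* if the codimension is greater than 1, then `D = 1`;
* if the codimension were 0, that is, `ℒ_{X,J} = ℂⁿ⁺¹`, then `D = 0`. -/
structure IsDXJ {n s k : ℕ} (g : Fin s → MvPolynomial (Fin (n + 1)) ℚ)
    (h : Fin k → MvPolynomial (Fin (n + 1)) ℚ) (D : MvPolynomial (Fin (n + 1)) ℚ) : Prop where
  codim_one : (idealLJ g h).height = 1 →
    ∃ (K : ℕ) (Dj : Fin K → MvPolynomial (Fin (n + 1)) ℚ),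
      Function.Injective (fun j => zeroLocus ℂ (Ideal.span {Dj j})) ∧
      Set.range (fun j => zeroLocus ℂ (Ideal.span {Dj j})) = codimOneComponents g h ∧
      (∀ j, (Ideal.span {Dj j}).IsRadical) ∧
      D = ∏ j, Dj j
  codim_gt_one : 1 < (idealLJ g h).height → D = 1
  codim_zero : (idealLJ g h).height = 0 → D = 0

/-- The parameters `(u₀, a₁, …, aₙ)`, with `u₀` the indeterminate of `K[u₀]`. -/
noncomputable def sample {n : ℕ} {K : Type} [Field K] (a : Fin n → K) :
    Fin (n + 1) → Polynomial K :=
  Fin.cons Polynomial.X (fun i => Polynomial.C (a i))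

/-- Replacing `uᵢ` by `aᵢ` for `i = 1, …, n` in a polynomial; the result lies in
`K[u₀][p, λ]`. -/
noncomputable def specialize {n k : ℕ} {K : Type} [Field K] [CharZero K] (a : Fin n → K) :
    MvPolynomial (Var n k) ℚ →ₐ[ℚ] MvPolynomial (Unknown n k) (Polynomial K) :=
  aeval (Sum.elim (fun i => C (sample a i)) X)

/-- The elimination ideal `⟨F₀, F₁*, …, Fₙ*, Fₙ₊₁, …, Fₘ, J⟩ ∩ K[u₀]`. -/
noncomputable def elimIdeal {n s k : ℕ} {K : Type} [Field K] [CharZero K]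
    (g : Fin s → MvPolynomial (Fin (n + 1)) ℚ) (h : Fin k → MvPolynomial (Fin (n + 1)) ℚ)
    (a : Fin n → K) : Ideal (Polynomial K) :=
  Ideal.comap C (Ideal.span (specialize a '' (likelihoodEqs g h ∪ {jacobianJ h})))

/-- An affine variety in `ℂⁿ`: the zero set of polynomials with rational coefficients. -/
def IsAffineVariety {n : ℕ} (V : Set (Fin n → ℂ)) : Prop :=
  ∃ I : Ideal (MvPolynomial (Fin n) ℚ), V = zeroLocus ℂ I

end LikelihoodDiscriminant

/-! Let `I` be the ideal of the closure of the projected solution set; by the Nullstellensatz it is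
`projIdeal E`. Only components of height one matter after specializing `u₁, …, uₙ` generically. The
reason is `exists_rename_succ_mem`: a prime of `R[X]` contracting to zero is controlled by a prime
of `Frac(R)[X]`, so it has height at most one. Hence every prime of larger height contains a nonzero
polynomial free of `u₀`, which becomes a unit at generic `a`.

Both inclusions rest on this. Some multiple `c₀ D` with `c₀ ≠ 0` free of `u₀` lies in `I`, so `D(u₀,
a)` lies in the radical of the elimination ideal. Conversely, a complex root `α` of `D(u₀, a)` puts
`(α, a)` on some component `dᵢ = 0`. By Chevalley's theorem (`exists_generic_lift`) the point lifts
to a solution unless some `eᵢ ∉ ⟨dᵢ⟩` vanishes there, and generic `a` avoids `dᵢ = eᵢ = 0`. So every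
`f` in the elimination ideal vanishes at `α`. As `D(u₀, a)` is separable for generic `a`
(`exists_rename_succ_mem_span_pderiv`), it divides `f`. The variety `V` is the zero set of the
product of the finitely many polynomials to be avoided. -/

namespace Elimination
-- Heights of primes and elimination of the first variable
section Algebra

/-- A prime of `R[X]` that meets the constants only in `0` has height at most one. -/
theorem height_le_one_of_comap_C_eq_bot {R : Type*} [CommRing R] [IsDomain R]
    (P : Ideal (Polynomial R)) [P.IsPrime] (hP : P.comap Polynomial.C = ⊥) : P.height ≤ 1 := by
  let F := FractionRing R
  let : Algebra (Polynomial R) (Polynomial F) := (Polynomial.mapRingHom (algebraMap R F)).toAlgebra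
  have hloc : IsLocalization ((nonZeroDivisors R).map Polynomial.C) (Polynomial F) :=
    Polynomial.isLocalization (nonZeroDivisors R) F
  have hdisj : Disjoint (((nonZeroDivisors R).map (Polynomial.C : R →+* Polynomial R) :
      Submonoid (Polynomial R)) : Set (Polynomial R)) (P : Set (Polynomial R)) := by
    rw [Set.disjoint_left]
    rintro _ ⟨r, hr, rfl⟩ hrP
    have : r ∈ P.comap Polynomial.C := hrP
    rw [hP, Ideal.mem_bot] at this
    exact nonZeroDivisors.ne_zero hr this
  -- Inverting the nonzero constants preserves the height of `P` and leads to `F[X]`, which has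
  -- dimension at most one.
  rw [← IsLocalization.height_map_of_disjoint (S := Polynomial F) _ P hdisj]
  have : (P.map (algebraMap (Polynomial R) (Polynomial F))).IsPrime :=
    IsLocalization.isPrime_of_isPrime_disjoint _ _ P ‹_› hdisj
  have h1 : ((P.map (algebraMap (Polynomial R) (Polynomial F))).height : WithBot ℕ∞) ≤ 1 :=
    Ideal.height_le_ringKrullDim_of_isPrime.trans Order.KrullDimLE.krullDim_le
  exact_mod_cast h1

/-- If every prime of height at most one over an ideal of `R[X]` contains a nonzero constant,
then so does the ideal. -/
theorem exists_C_mem {R : Type*} [CommRing R] [IsDomain R] (I : Ideal (Polynomial R))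
    (h : ∀ P : Ideal (Polynomial R), P.IsPrime → I ≤ P → P.height ≤ 1 →
      ∃ c ≠ 0, Polynomial.C c ∈ P) :
    ∃ c ≠ 0, Polynomial.C c ∈ I := by
  by_contra! hI
  obtain ⟨P, hP, hIP, hdisj⟩ := Ideal.exists_le_prime_disjoint I
    ((nonZeroDivisors R).map (Polynomial.C : R →+* Polynomial R)) (by
      rw [Set.disjoint_left]
      rintro _ hx ⟨r, hr, rfl⟩
      exact hI r (nonZeroDivisors.ne_zero hr) hx)
  have hbot : ∀ c ≠ 0, Polynomial.C c ∉ P := fun c hc hcP =>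
    Set.disjoint_left.mp hdisj hcP ⟨c, mem_nonZeroDivisors_of_ne_zero hc, rfl⟩
  have hheight := height_le_one_of_comap_C_eq_bot P (by
    rw [eq_bot_iff]
    intro c hc
    by_contra hc0
    exact hbot c hc0 hc)
  obtain ⟨c, hc, hcP⟩ := h P hP hIP hheight
  exact hbot c hc hcP

variable {k : Type*} [Field k] {n : ℕ}

theorem finSuccEquiv_rename_succ (c : MvPolynomial (Fin n) k) :
    finSuccEquiv k n (rename Fin.succ c) = Polynomial.C c := by
  induction c using MvPolynomial.induction_on with
  | C a => simp [finSuccEquiv_apply]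
  | add p q hp hq => simp [hp, hq]
  | mul_X p i hp => simp [hp, finSuccEquiv_X_succ]

theorem finSuccEquiv_pderiv_zero (f : MvPolynomial (Fin (n + 1)) k) :
    finSuccEquiv k n (pderiv 0 f) = Polynomial.derivative (finSuccEquiv k n f) := by
  induction f using MvPolynomial.induction_on with
  | C a => simp [finSuccEquiv_apply]
  | add p q hp hq => simp [hp, hq]
  | mul_X p i hp =>
    rw [Derivation.leibniz, map_mul, Polynomial.derivative_mul]
    refine Fin.cases ?_ (fun i => ?_) i
    · simp [hp, finSuccEquiv_X_zero]; ring
    · simp [hp, finSuccEquiv_X_succ, pderiv_X_of_ne (Fin.succ_ne_zero i)]; ring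

/-- If every prime of height at most one over an ideal contains a nonzero polynomial not involving
the first variable, then so does the ideal. -/
theorem exists_rename_succ_mem (I : Ideal (MvPolynomial (Fin (n + 1)) k))
    (h : ∀ P : Ideal (MvPolynomial (Fin (n + 1)) k), P.IsPrime → I ≤ P → P.height ≤ 1 →
      ∃ c ≠ 0, rename Fin.succ c ∈ P) :
    ∃ c ≠ 0, rename Fin.succ c ∈ I := by
  let e := (finSuccEquiv k n).toRingEquiv
  have he : ∀ c, e.symm (Polynomial.C c) = rename Fin.succ c := fun c => by
    rw [RingEquiv.symm_apply_eq]; exact (finSuccEquiv_rename_succ c).symm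
  obtain ⟨c, hc, hcI⟩ := exists_C_mem (I.comap e.symm) fun P hP hIP hPh => by
    obtain ⟨c, hc, hcP⟩ := h (P.comap e) inferInstance
      (fun x hx => hIP (by simpa [Ideal.mem_comap] using hx)) (by rwa [RingEquiv.height_comap])
    exact ⟨c, hc, by
      rw [Ideal.mem_comap] at hcP
      rwa [← finSuccEquiv_rename_succ]⟩
  exact ⟨c, hc, by rwa [Ideal.mem_comap, he] at hcI⟩

/-- A proper closed subset of an irreducible hypersurface has codimension at least two, so no prime
of height at most one needs to be checked. -/
theorem exists_rename_succ_mem_sup_span {P : Ideal (MvPolynomial (Fin (n + 1)) k)}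
    (hP : P.IsPrime) (hPh : P.height = 1) {e : MvPolynomial (Fin (n + 1)) k} (he : e ∉ P) :
    ∃ c ≠ 0, rename Fin.succ c ∈ P ⊔ Ideal.span {e} := by
  refine exists_rename_succ_mem _ fun Q hQ hle hQh => (he ?_).elim
  have hPQ : P = Q := Ideal.eq_of_le_of_height_le _ (le_sup_left.trans hle) (hQh.trans hPh.ge)
  rw [hPQ]
  exact hle (Ideal.mem_sup_right (Ideal.mem_span_singleton_self e))

/-- A polynomial that lies in all minimal primes of height at most one of a radical ideal lies in
the ideal after multiplication by a nonzero polynomial not involving the first variable. -/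
theorem exists_rename_succ_mul_mem {I : Ideal (MvPolynomial (Fin (n + 1)) k)} (hI : I.IsRadical)
    {D : MvPolynomial (Fin (n + 1)) k} (hD : ∀ P ∈ I.minimalPrimes, P.height ≤ 1 → D ∈ P) :
    ∃ c ≠ 0, rename Fin.succ c * D ∈ I := by
  have hfin : {P | P ∈ I.minimalPrimes ∧ ¬ P.height ≤ 1}.Finite :=
    (I.finite_minimalPrimes_of_isNoetherianRing).subset fun P hP => hP.1
  -- The condition on primes is vacuous: a prime over this finite intersection contains one of the
  -- `P`, hence has height above one.
  obtain ⟨c, hc, hcm⟩ := exists_rename_succ_mem (hfin.toFinset.inf id) fun Q hQ hle hQh => by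
    obtain ⟨P, hP, hPQ⟩ := (Ideal.IsPrime.inf_le' hQ).mp hle
    exact ((hfin.mem_toFinset.mp hP).2 ((Ideal.height_mono hPQ).trans hQh)).elim
  refine ⟨c, hc, ?_⟩
  rw [← hI.radical, ← Ideal.sInf_minimalPrimes, Ideal.mem_sInf]
  intro P hP
  by_cases hPh : P.height ≤ 1
  · exact P.mul_mem_left _ (hD P hP hPh)
  · exact P.mul_mem_right _
      (Finset.inf_le (f := id) (hfin.mem_toFinset.mpr ⟨hP, hPh⟩) hcm)

/-- A product of non-associated primes is generically separable in the first variable. -/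
theorem exists_rename_succ_mem_span_pderiv [CharZero k] {ι : Type*} [Fintype ι]
    (d : ι → MvPolynomial (Fin (n + 1)) k) (hprime : ∀ i, (Ideal.span {d i}).IsPrime)
    (hheight : ∀ i, (Ideal.span {d i}).height = 1)
    (hinj : Function.Injective fun i => Ideal.span {d i}) :
    ∃ c ≠ 0, rename Fin.succ c ∈ Ideal.span {∏ i, d i, pderiv 0 (∏ i, d i)} := by
  classical
  refine exists_rename_succ_mem _ fun Q hQ hle hQh => ?_
  have hDQ : ∏ i, d i ∈ Q := hle (Ideal.subset_span (by simp))
  have hD'Q : pderiv 0 (∏ i, d i) ∈ Q := hle (Ideal.subset_span (by simp))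
  obtain ⟨j, -, hj⟩ := hQ.prod_mem_iff.mp hDQ
  have := hprime j
  have heq : ∀ i, d i ∈ Q → Ideal.span {d i} = Q := fun i hi =>
    have := hprime i
    Ideal.eq_of_le_of_height_le _ ((Ideal.span_singleton_le_iff_mem _).mpr hi)
      (hQh.trans (hheight i).ge)
  have hQj := heq j hj
  have hE : ∏ i ∈ Finset.univ.erase j, d i ∉ Q := fun hmem => by
    obtain ⟨i, hi, hiQ⟩ := hQ.prod_mem_iff.mp hmem
    exact Finset.ne_of_mem_erase hi (hinj ((heq i hiQ).trans hQj.symm))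
  -- Modulo `Q`, the product rule leaves only the derivative of `d j` times the other factors, and
  -- none of these lies in `Q`.
  rw [← Finset.mul_prod_erase Finset.univ d (Finset.mem_univ j), Derivation.leibniz, smul_eq_mul,
    smul_eq_mul, Ideal.add_mem_iff_right _ (Q.mul_mem_right _ hj)] at hD'Q
  have hdj : pderiv 0 (d j) ∈ Q := (hQ.mem_or_mem hD'Q).resolve_left hE
  rw [← hQj, Ideal.mem_span_singleton] at hdj
  -- In characteristic zero a polynomial divides its derivative only if the derivative is zero; so
  -- `d j` itself is free of the first variable.
  have hder := map_dvd (finSuccEquiv k n) hdj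
  rw [finSuccEquiv_pderiv_zero, Polynomial.dvd_derivative_iff] at hder
  have hconst := Polynomial.eq_C_of_natDegree_eq_zero
    (Polynomial.derivative_eq_zero.mp hder)
  rw [← finSuccEquiv_rename_succ, EmbeddingLike.apply_eq_iff_eq] at hconst
  refine ⟨_, fun h0 => ?_, hconst ▸ hj⟩
  rw [h0, map_zero] at hconst
  have := hheight j
  simp [hconst] at this

end Algebra

/-! ### Extending points along algebras of finite type -/

section Extension

/-- A nonzero algebra of finite type over a field has points in every algebraically closed
extension of the field. -/
theorem nonempty_algHom (k T Ω : Type*) [Field k] [CommRing T] [Nontrivial T] [Algebra k T]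
    [Algebra.FiniteType k T] [Field Ω] [IsAlgClosed Ω] [Algebra k Ω] : Nonempty (T →ₐ[k] Ω) := by
  obtain ⟨m, hm⟩ := Ideal.exists_maximal T
  let : Field (T ⧸ m) := Ideal.Quotient.field m
  have : Module.Finite k (T ⧸ m) := finite_of_finite_type_of_isJacobsonRing k (T ⧸ m)
  let χ : (T ⧸ m) →ₐ[k] Ω := IsAlgClosed.lift
  exact ⟨χ.comp (Ideal.Quotient.mkₐ k m)⟩

/-- A homomorphism to an algebraically closed field extends along an algebra of finite type if its
kernel is the contraction of a prime. -/
theorem exists_extension {A B Ω : Type*} [CommRing A] [CommRing B] [Algebra A B]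
    [Algebra.FiniteType A B] [Field Ω] [IsAlgClosed Ω] (φ : A →+* Ω) (q : Ideal B) [q.IsPrime]
    (hq : q.comap (algebraMap A B) = RingHom.ker φ) :
    ∃ ψ : B →+* Ω, ψ.comp (algebraMap A B) = φ := by
  let p : PrimeSpectrum A := ⟨RingHom.ker φ, RingHom.ker_isPrime φ⟩
  have hp : p.asIdeal.IsPrime := p.isPrime
  -- The prime `q` is a point of the fibre over `ker φ`; an `Ω`-point of this fibre is the desired
  -- extension.
  have : Nontrivial (p.asIdeal.Fiber B) :=
    PrimeSpectrum.nonempty_iff_nontrivial.mp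
      ⟨PrimeSpectrum.preimageOrderIsoFiber A B p ⟨⟨q, ‹_›⟩, PrimeSpectrum.ext hq⟩⟩
  let κ := p.asIdeal.ResidueField
  let φκ : κ →+* Ω := Ideal.ResidueField.lift p.asIdeal φ le_rfl fun x hx =>
    (show φ x ≠ 0 from fun h => hx h).isUnit
  let : Algebra κ Ω := φκ.toAlgebra
  obtain ⟨χ⟩ := nonempty_algHom κ (p.asIdeal.Fiber B) Ω
  refine ⟨(χ : p.asIdeal.Fiber B →+* Ω).comp
    (Algebra.TensorProduct.includeRight : B →ₐ[A] p.asIdeal.Fiber B).toRingHom, ?_⟩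
  ext a
  have h1 : (Algebra.TensorProduct.includeRight : B →ₐ[A] p.asIdeal.Fiber B) (algebraMap A B a) =
      algebraMap κ (p.asIdeal.Fiber B) (algebraMap A κ a) := by
    rw [AlgHom.commutes, ← IsScalarTower.algebraMap_apply]
  have h2 : χ (algebraMap κ _ (algebraMap A κ a)) = φκ (algebraMap A κ a) := χ.commutes _
  have h3 : φκ (algebraMap A κ a) = φ a := Ideal.ResidueField.lift_algebraMap _ _ _ _ _
  rw [← h3, ← h2]
  exact congrArg χ h1

/-- Generic surjectivity: the homomorphisms that kill the contraction `P` of a prime `Q`, but not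
a certain element outside `P`, extend to homomorphisms that kill `Q`. -/
theorem exists_generic_extension {A B : Type*} [CommRing A] [IsNoetherianRing A] [CommRing B]
    [Algebra A B] [Algebra.FiniteType A B] (Q : Ideal B) [Q.IsPrime] :
    ∃ e ∉ Q.comap (algebraMap A B), ∀ (Ω : Type) [Field Ω] [IsAlgClosed Ω] (φ : A →+* Ω),
      Q.comap (algebraMap A B) ≤ RingHom.ker φ → φ e ≠ 0 →
        ∃ ψ : B →+* Ω, ψ.comp (algebraMap A B) = φ ∧ Q ≤ RingHom.ker ψ := by
  have hfp : (algebraMap A (B ⧸ Q)).FinitePresentation := by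
    rw [RingHom.finitePresentation_algebraMap]
    exact Algebra.FinitePresentation.of_finiteType.mp inferInstance
  -- Chevalley: the image of `Spec (B ⧸ Q)` is constructible. The locally closed piece that holds
  -- the generic point of the image provides `e` as its inequation `c.f`.
  obtain ⟨S, hS⟩ := PrimeSpectrum.exists_constructibleSetData_iff.mpr
    (PrimeSpectrum.isConstructible_range_comap hfp)
  have hcomap : (⊥ : Ideal (B ⧸ Q)).comap (algebraMap A (B ⧸ Q)) = Q.comap (algebraMap A B) := by
    ext x
    rw [Ideal.mem_comap, Ideal.mem_comap, IsScalarTower.algebraMap_apply A B (B ⧸ Q), Ideal.mem_bot]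
    exact Ideal.Quotient.eq_zero_iff_mem
  have hmem : PrimeSpectrum.comap (algebraMap A (B ⧸ Q)) ⟨⊥, Ideal.isPrime_bot⟩ ∈ S.toSet :=
    hS ▸ Set.mem_range_self _
  simp only [PrimeSpectrum.ConstructibleSetData.toSet, Set.mem_iUnion] at hmem
  obtain ⟨c, hcS, hg, hf⟩ := hmem
  rw [PrimeSpectrum.mem_zeroLocus] at hg hf
  simp only [PrimeSpectrum.comap_asIdeal, hcomap] at hg hf
  refine ⟨c.f, fun h => hf (by simpa using h), fun Ω _ _ φ hφ he => ?_⟩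
  have hφS : (⟨RingHom.ker φ, RingHom.ker_isPrime φ⟩ : PrimeSpectrum A) ∈ S.toSet := by
    simp only [PrimeSpectrum.ConstructibleSetData.toSet, Set.mem_iUnion]
    refine ⟨c, hcS, ?_, ?_⟩
    · exact (PrimeSpectrum.mem_zeroLocus _ _).mpr (hg.trans hφ)
    · rw [PrimeSpectrum.mem_zeroLocus]
      simpa using he
  rw [hS] at hφS
  obtain ⟨q, hq⟩ := hφS
  obtain ⟨ψ, hψ⟩ := exists_extension (B := B ⧸ Q) φ q.asIdeal (congrArg PrimeSpectrum.asIdeal hq)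
  refine ⟨ψ.comp (Ideal.Quotient.mk Q), ?_, fun x hx => ?_⟩
  · rw [← hψ, IsScalarTower.algebraMap_eq A B (B ⧸ Q)]; rfl
  · simp [RingHom.mem_ker, Ideal.Quotient.eq_zero_iff_mem.mpr hx]

end Extension


/-! ### The closure of the projection and its generic points -/

open LikelihoodDiscriminant

variable {n k : ℕ}

/-- The polynomials in the parameters that vanish on the projection of the complex zeros of a
system, described algebraically. -/
noncomputable def projIdeal (E : Set (MvPolynomial (Var n k) ℚ)) :
    Ideal (MvPolynomial (Fin (n + 1)) ℚ) :=
  (Ideal.span E).radical.comap (rename Sum.inl : _ →ₐ[ℚ] MvPolynomial (Var n k) ℚ)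

theorem isRadical_projIdeal (E : Set (MvPolynomial (Var n k) ℚ)) : (projIdeal E).IsRadical :=
  (Ideal.radical_isRadical _).comap _

theorem projIdeal_eq_vanishingIdeal (E : Set (MvPolynomial (Var n k) ℚ)) :
    projIdeal E = vanishingIdeal ℚ (proj '' zeroLocus ℂ (Ideal.span E)) := by
  ext f
  rw [projIdeal, Ideal.mem_comap, ← vanishingIdeal_zeroLocus_eq_radical (K := ℂ)]
  simp only [mem_vanishingIdeal_iff, Set.forall_mem_image, aeval_rename]
  rfl

/-- A generic point of a component of the closure of the projection lifts to a zero. -/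
theorem exists_generic_lift {E : Set (MvPolynomial (Var n k) ℚ)}
    {P : Ideal (MvPolynomial (Fin (n + 1)) ℚ)} (hP : P ∈ (projIdeal E).minimalPrimes) :
    ∃ e ∉ P, ∀ x : Fin (n + 1) → ℂ, (∀ f ∈ P, aeval x f = 0) → aeval x e ≠ 0 →
      ∃ v ∈ zeroLocus ℂ (Ideal.span E), ∀ i, v (Sum.inl i) = x i := by
  obtain ⟨Q, hQ, hEQ, rfl⟩ := Ideal.exists_comap_eq_of_mem_minimalPrimes _ P hP
  let : Algebra (MvPolynomial (Fin (n + 1)) ℚ) (MvPolynomial (Var n k) ℚ) :=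
    (rename Sum.inl : _ →ₐ[ℚ] MvPolynomial (Var n k) ℚ).toRingHom.toAlgebra
  have : IsScalarTower ℚ (MvPolynomial (Fin (n + 1)) ℚ) (MvPolynomial (Var n k) ℚ) :=
    IsScalarTower.of_algebraMap_eq fun r =>
      ((rename Sum.inl : _ →ₐ[ℚ] MvPolynomial (Var n k) ℚ).commutes r).symm
  have : Algebra.FiniteType (MvPolynomial (Fin (n + 1)) ℚ) (MvPolynomial (Var n k) ℚ) :=
    Algebra.FiniteType.of_restrictScalars_finiteType ℚ _ _
  obtain ⟨e, he, hext⟩ := exists_generic_extension (A := MvPolynomial (Fin (n + 1)) ℚ) Q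
  refine ⟨e, he, fun x hx hxe => ?_⟩
  obtain ⟨ψ, hψ, hQψ⟩ := hext ℂ (aeval x : _ →ₐ[ℚ] ℂ).toRingHom (fun f hf => hx f hf) hxe
  have hψ' : ∀ f, aeval (fun i => ψ (X i)) f = ψ f := fun f => by
    exact (DFunLike.congr_fun (aeval_unique ψ.toRatAlgHom) f).symm
  refine ⟨fun i => ψ (X i), fun f hf => ?_, fun i => ?_⟩
  · rw [hψ']
    exact hQψ (hEQ (Ideal.le_radical hf))
  · have := RingHom.congr_fun hψ (X i)
    simpa [RingHom.algebraMap_toAlgebra] using this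

/-! ### Specialization of the parameters -/

section Specialization

variable {K : Type} [Field K] [CharZero K] (a : Fin n → K)

theorem aeval_sample (f : MvPolynomial (Fin (n + 1)) ℚ) :
    aeval (sample a) f = (finSuccEquiv ℚ n f).map (aeval a : _ →ₐ[ℚ] K).toRingHom := by
  induction f using MvPolynomial.induction_on with
  | C r => simp [finSuccEquiv_apply, IsScalarTower.algebraMap_apply ℚ K (Polynomial K)]
  | add p q hp hq => simp [hp, hq]
  | mul_X p i hp =>
    rw [map_mul, map_mul, Polynomial.map_mul, hp, aeval_X]
    congr 1
    refine Fin.cases ?_ (fun i => ?_) i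
    · simp [finSuccEquiv_X_zero, sample]
    · simp [finSuccEquiv_X_succ, sample]

theorem aeval_sample_rename_succ (c : MvPolynomial (Fin n) ℚ) :
    aeval (sample a) (rename Fin.succ c) = Polynomial.C (aeval a c) := by
  simp [aeval_sample, finSuccEquiv_rename_succ]

theorem aeval_sample_pderiv (f : MvPolynomial (Fin (n + 1)) ℚ) :
    aeval (sample a) (pderiv 0 f) = Polynomial.derivative (aeval (sample a) f) := by
  simp [aeval_sample, finSuccEquiv_pderiv_zero]

theorem specialize_rename_inl (f : MvPolynomial (Fin (n + 1)) ℚ) :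
    specialize (k := k) a (rename Sum.inl f) = C (aeval (sample a) f) := by
  induction f using MvPolynomial.induction_on with
  | C r => simp [IsScalarTower.algebraMap_apply ℚ (Polynomial K) (MvPolynomial _ (Polynomial K)),
      specialize, algebraMap_eq]
  | add p q hp hq => simp [hp, hq]
  | mul_X p i hp => simp [hp]; simp [specialize]

/-- The elimination ideal of the specialized system in `K[u₀]`. -/
noncomputable def elim (E : Set (MvPolynomial (Var n k) ℚ)) : Ideal (Polynomial K) :=
  Ideal.comap C (Ideal.span (specialize a '' E))

variable {a}

/-- Under specialization `c` becomes a nonzero constant of `K`, a unit that can be cancelled. -/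
theorem aeval_sample_mem_radical_elim {E : Set (MvPolynomial (Var n k) ℚ)}
    {c : MvPolynomial (Fin n) ℚ} {f : MvPolynomial (Fin (n + 1)) ℚ}
    (hc : rename Fin.succ c * f ∈ projIdeal E) (hca : aeval a c ≠ 0) :
    aeval (sample a) f ∈ (elim a E).radical := by
  obtain ⟨N, hN⟩ := hc
  have h := Ideal.mem_map_of_mem (specialize a) hN
  rw [Ideal.map_span] at h
  have h' : aeval (sample a) (rename Fin.succ c * f) ∈ (elim a E).radical := by
    refine ⟨N, ?_⟩
    rw [elim, Ideal.mem_comap, map_pow, ← specialize_rename_inl, ← map_pow]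
    exact h
  rw [map_mul, aeval_sample_rename_succ] at h'
  exact (Ideal.unit_mul_mem_iff_mem _ (Polynomial.isUnit_C.mpr hca.isUnit)).mp h'

variable [Algebra K ℂ]

theorem aeval_aeval_sample (α : ℂ) (f : MvPolynomial (Fin (n + 1)) ℚ) :
    Polynomial.aeval α (aeval (sample a) f) =
      aeval (Fin.cons α fun i => algebraMap K ℂ (a i) : Fin (n + 1) → ℂ) f := by
  induction f using MvPolynomial.induction_on with
  | C r => simp
  | add p q hp hq => simp [hp, hq]
  | mul_X p i hp =>
    rw [map_mul, map_mul, map_mul, hp, aeval_X, aeval_X]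
    congr 1
    refine Fin.cases ?_ (fun i => ?_) i <;> simp [sample]

/-- Evaluation at the solution `v` factors through the specialized ring and kills the specialized
system. -/
theorem aeval_eq_zero_of_mem_elim {E : Set (MvPolynomial (Var n k) ℚ)} {f : Polynomial K}
    (hf : f ∈ elim a E) {α : ℂ} {v : Var n k → ℂ} (hv : v ∈ zeroLocus ℂ (Ideal.span E))
    (hvα : ∀ i, v (Sum.inl i) = (Fin.cons α fun i => algebraMap K ℂ (a i) : Fin (n + 1) → ℂ) i) :
    Polynomial.aeval α f = 0 := by
  let θ : MvPolynomial (Unknown n k) (Polynomial K) →+* ℂ :=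
    eval₂Hom (Polynomial.aeval α : Polynomial K →ₐ[K] ℂ).toRingHom fun i => v (Sum.inr i)
  have hθ : ∀ g, θ (specialize a g) = aeval v g := fun g => by
    induction g using MvPolynomial.induction_on with
    | C r => simp [θ]
    | add p q hp hq => simp [hp, hq]
    | mul_X p i hp =>
      rw [map_mul, map_mul, map_mul, hp, aeval_X]
      congr 1
      rcases i with i | i
      · rw [hvα]
        refine Fin.cases ?_ (fun i => ?_) i <;> simp [specialize, θ, sample]
      · simp [specialize, θ]
  have hle : Ideal.span (specialize a '' E) ≤ RingHom.ker θ := by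
    rw [Ideal.span_le]
    rintro _ ⟨g, hg, rfl⟩
    exact (hθ g).trans (hv g (Ideal.subset_span hg))
  have := hle hf
  simpa [θ] using this

end Specialization

/-! ### The elimination ideal at generic parameters -/

/-- A separable polynomial divides every polynomial that vanishes at its complex roots. -/
theorem dvd_of_separable {K : Type*} [Field K] [Algebra K ℂ] {p f : Polynomial K}
    (hp : p.Separable) (h : ∀ α : ℂ, Polynomial.aeval α p = 0 → Polynomial.aeval α f = 0) :
    p ∣ f := by
  rcases eq_or_ne f 0 with rfl | hf
  · exact dvd_zero p
  rw [← Polynomial.map_dvd_map' (algebraMap K ℂ)]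
  have hp' : (p.map (algebraMap K ℂ)).Separable := hp.map
  refine (IsAlgClosed.splits _).dvd_of_roots_le_roots hp'.ne_zero ?_
  rw [Multiset.le_iff_subset (Polynomial.nodup_roots hp')]
  intro α hα
  rw [Polynomial.mem_roots_map hp.ne_zero] at hα
  rw [Polynomial.mem_roots_map hf]
  exact h α hα

/-- The elimination ideal vanishes generically if the projection is dense. -/
theorem radical_elim_eq_bot {E : Set (MvPolynomial (Var n k) ℚ)} (hE : projIdeal E = ⊥) :
    ∃ c : MvPolynomial (Fin n) ℚ, c ≠ 0 ∧
      ∀ (K : Type) [Field K] [CharZero K] [Algebra K ℂ] (a : Fin n → K), aeval a c ≠ 0 →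
        (elim a E).radical = ⊥ := by
  have hmin : ⊥ ∈ (projIdeal E).minimalPrimes := by
    rw [hE, Ideal.minimalPrimes_eq_subsingleton_self]
    exact Set.mem_singleton _
  obtain ⟨e, he, hlift⟩ := exists_generic_lift hmin
  have he0 : finSuccEquiv ℚ n e ≠ 0 := by simpa using he
  -- If the leading coefficient of `e` in `u₀` survives at `a`, then `e(u₀, a)` is not the zero
  -- polynomial.
  refine ⟨(finSuccEquiv ℚ n e).leadingCoeff, by simpa using he, fun K _ _ _ a hca => ?_⟩
  rw [Ideal.radical_eq_iff.mpr (show (⊥ : Ideal (Polynomial K)).IsRadical from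
    Ideal.isPrime_bot.isRadical) |>.symm]
  congr 1
  rw [eq_bot_iff]
  intro f hf
  rw [Ideal.mem_bot]
  have hea : aeval (sample a) e ≠ 0 := fun h => hca (by
    rw [aeval_sample] at h
    simpa using congrArg (Polynomial.coeff · (finSuccEquiv ℚ n e).natDegree) h)
  -- At each complex `α`, either `e(α, a) = 0` or `(α, a)` lifts to a solution and `f(α) = 0`.
  have hprod : f * aeval (sample a) e = 0 := by
    refine Polynomial.map_injective _ (algebraMap K ℂ).injective ?_
    rw [Polynomial.map_zero]
    refine Polynomial.funext fun α => ?_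
    rw [Polynomial.eval_map_algebraMap, map_mul, Polynomial.eval_zero, mul_eq_zero,
      aeval_aeval_sample]
    by_contra! hne
    obtain ⟨v, hv, hvα⟩ := hlift _ (by simp) hne.2
    exact hne.1 (aeval_eq_zero_of_mem_elim hf hv hvα)
  exact (mul_eq_zero.mp hprod).resolve_right hea

/-- The elimination ideal is generically cut out by the equations of the components of
codimension one, if the projection is not dense. -/
theorem radical_elim_eq_span {E : Set (MvPolynomial (Var n k) ℚ)} {ι : Type*} [Fintype ι]
    (d : ι → MvPolynomial (Fin (n + 1)) ℚ)
    (hmin : ∀ i, Ideal.span {d i} ∈ (projIdeal E).minimalPrimes)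
    (hheight : ∀ i, (Ideal.span {d i}).height = 1)
    (hinj : Function.Injective fun i => Ideal.span {d i})
    (hcov : ∀ P ∈ (projIdeal E).minimalPrimes, P.height ≤ 1 → ∃ i, Ideal.span {d i} = P) :
    ∃ c : MvPolynomial (Fin n) ℚ, c ≠ 0 ∧
      ∀ (K : Type) [Field K] [CharZero K] [Algebra K ℂ] (a : Fin n → K), aeval a c ≠ 0 →
        (elim a E).radical = Ideal.span {aeval (sample a) (∏ i, d i)} := by
  have hprime : ∀ i, (Ideal.span {d i}).IsPrime := fun i => (hmin i).isPrime
  obtain ⟨c₀, hc₀, hmem₀⟩ := exists_rename_succ_mul_mem (isRadical_projIdeal E)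
    (D := ∏ i, d i) fun P hP hPh => by
      obtain ⟨i, rfl⟩ := hcov P hP hPh
      exact Ideal.mem_span_singleton.mpr (Finset.dvd_prod_of_mem d (Finset.mem_univ i))
  obtain ⟨c₁, hc₁, hmem₁⟩ := exists_rename_succ_mem_span_pderiv d hprime hheight hinj
  choose e he hlift using fun i => exists_generic_lift (hmin i)
  choose b hb hmemb using fun i => exists_rename_succ_mem_sup_span (hprime i) (hheight i) (he i)
  refine ⟨c₀ * c₁ * ∏ i, b i, mul_ne_zero (mul_ne_zero hc₀ hc₁)
    (Finset.prod_ne_zero_iff.mpr fun i _ => hb i), fun K _ _ _ a hca => ?_⟩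
  simp only [map_mul, map_prod, mul_ne_zero_iff, Finset.prod_ne_zero_iff] at hca
  obtain ⟨⟨hca₀, hca₁⟩, hcb⟩ := hca
  have hsep : (aeval (sample a) (∏ i, d i)).Separable := by
    obtain ⟨s, t, hst⟩ := Ideal.mem_span_pair.mp hmem₁
    have h := congrArg (aeval (sample a)) hst
    rw [map_add, map_mul, map_mul, aeval_sample_pderiv, aeval_sample_rename_succ] at h
    refine ⟨Polynomial.C (aeval a c₁)⁻¹ * aeval (sample a) s,
      Polynomial.C (aeval a c₁)⁻¹ * aeval (sample a) t, ?_⟩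
    rw [mul_assoc, mul_assoc, ← mul_add, h, ← Polynomial.C_mul, inv_mul_cancel₀ hca₁,
      Polynomial.C_1]
  apply le_antisymm
  · rintro f ⟨N, hf⟩
    rw [Ideal.mem_span_singleton]
    refine hsep.squarefree.isRadical N f (dvd_of_separable hsep fun α hα => ?_)
    rw [aeval_aeval_sample, map_prod, Finset.prod_eq_zero_iff] at hα
    obtain ⟨i, -, hi⟩ := hα
    obtain ⟨v, hv, hvα⟩ := hlift i _ (fun g hg => by
      obtain ⟨r, rfl⟩ := Ideal.mem_span_singleton.mp hg
      rw [map_mul, hi, zero_mul]) (fun hei => by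
      -- If `d i` and `e i` both vanished at `(α, a)`, so would `b i`, which depends on `a` alone
      -- and is nonzero there.
      obtain ⟨y, hy, z, hz, hyz⟩ := Submodule.mem_sup.mp (hmemb i)
      obtain ⟨y, rfl⟩ := Ideal.mem_span_singleton.mp hy
      obtain ⟨z, rfl⟩ := Ideal.mem_span_singleton.mp hz
      have h := congrArg (fun q => Polynomial.aeval α (aeval (sample a) q)) hyz
      simp only [aeval_sample_rename_succ, Polynomial.aeval_C, aeval_aeval_sample, map_add, map_mul,
        hi, hei, zero_mul, add_zero] at h
      exact hcb i (Finset.mem_univ i)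
        ((map_eq_zero_iff _ (algebraMap K ℂ).injective).mp h.symm))
    exact aeval_eq_zero_of_mem_elim hf hv hvα
  · rw [Ideal.span_singleton_le_iff_mem]
    exact aeval_sample_mem_radical_elim hmem₀ hca₀

/-! ### Application to the likelihood discriminant -/

theorem idealLJ_eq_projIdeal {s : ℕ} (g : Fin s → MvPolynomial (Fin (n + 1)) ℚ)
    (h : Fin k → MvPolynomial (Fin (n + 1)) ℚ) :
    idealLJ g h = projIdeal (likelihoodEqs g h ∪ {jacobianJ h}) := by
  rw [projIdeal_eq_vanishingIdeal, idealLJ, correspondence]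
  congr 2
  simp only [zeroLocus_span]
  ext v
  simp only [Set.mem_inter_iff, Set.mem_ofPred_eq, Set.mem_union, or_imp, forall_and]

/-- The defining property of the discriminant yields the specialization property off the zeros
of one polynomial. -/
theorem exists_radical_elimIdeal_eq {s : ℕ} {g : Fin s → MvPolynomial (Fin (n + 1)) ℚ}
    {h : Fin k → MvPolynomial (Fin (n + 1)) ℚ} {D : MvPolynomial (Fin (n + 1)) ℚ}
    (hD : IsDXJ g h D) :
    ∃ c : MvPolynomial (Fin n) ℚ, c ≠ 0 ∧
      ∀ (K : Type) [Field K] [CharZero K] [Algebra K ℂ] (a : Fin n → K), aeval a c ≠ 0 →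
        (elimIdeal g h a).radical = Ideal.span {aeval (sample a) D} := by
  have hLJ := idealLJ_eq_projIdeal g h
  have hle : ∀ P ∈ (idealLJ g h).minimalPrimes, (idealLJ g h).height ≤ P.height := fun P hP =>
    Ideal.height_mono hP.1.2
  rcases lt_trichotomy (idealLJ g h).height 1 with h0 | h1 | h2
  · have h0 := Order.lt_one_iff.mp h0
    obtain ⟨c, hc, H⟩ := radical_elim_eq_bot (hLJ ▸ Ideal.height_eq_zero_iff_eq_bot.mp h0)
    refine ⟨c, hc, fun K _ _ _ a hca => (H K a hca).trans ?_⟩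
    simp [hD.codim_zero h0]
  · obtain ⟨K, d, hinj, hrange, hrad, rfl⟩ := hD.codim_one h1
    have hspan : ∀ i, vanishingIdeal ℚ (zeroLocus ℂ (Ideal.span {d i})) = Ideal.span {d i} :=
      fun i => (vanishingIdeal_zeroLocus_eq_radical _).trans (hrad i).radical
    have hcomp : ∀ i, Ideal.span {d i} ∈ (idealLJ g h).minimalPrimes ∧
        (Ideal.span {d i}).height = 1 := fun i => by
      obtain ⟨P, hP, hPh, hZ⟩ := hrange ▸ Set.mem_range_self (f := fun j => zeroLocus ℂ _) i
      have := hP.isPrime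
      have hPd : Ideal.span {d i} = P := by
        rw [← hspan i, show zeroLocus ℂ (Ideal.span {d i}) = zeroLocus ℂ P from hZ,
          IsPrime.vanishingIdeal_zeroLocus]
      exact hPd ▸ ⟨hP, hPh⟩
    refine radical_elim_eq_span d (fun i => hLJ ▸ (hcomp i).1) (fun i => (hcomp i).2)
      (fun i j hij => hinj (congrArg (zeroLocus ℂ) hij)) fun P hP hPh => ?_
    rw [← hLJ] at hP
    have := hP.isPrime
    have hZ : zeroLocus ℂ P ∈ codimOneComponents g h :=
      ⟨P, hP, hPh.antisymm (h1 ▸ hle P hP), rfl⟩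
    rw [← hrange] at hZ
    obtain ⟨i, hi⟩ := hZ
    exact ⟨i, by rw [← hspan i, show zeroLocus ℂ (Ideal.span {d i}) = zeroLocus ℂ P from hi,
      IsPrime.vanishingIdeal_zeroLocus]⟩
  -- Codimension above one is the case of an empty family of components, with empty product `1`.
  · obtain ⟨c, hc, H⟩ := radical_elim_eq_span (E := likelihoodEqs g h ∪ {jacobianJ h})
      (fun i : Fin 0 => i.elim0) (fun i => i.elim0) (fun i => i.elim0) (fun i => i.elim0)
      fun P hP hPh => ((hPh.trans_lt h2).not_ge (hle P (hLJ ▸ hP))).elim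
    exact ⟨c, hc, fun K _ _ _ a hca => (H K a hca).trans (by simp [hD.codim_gt_one h2])⟩

end Elimination

/- The generic specialization property holds for the discriminant of any polynomial system over `ℚ`:
the geometric hypotheses `hg` and `hh` on the model are not used. -/
open LikelihoodDiscriminant in
theorem corollary2 {n s k : ℕ}
    (g : Fin s → MvPolynomial (Fin (n + 1)) ℚ)
    (h : Fin k → MvPolynomial (Fin (n + 1)) ℚ)
    (hg : IsModel g)
    (hh : IsGeneralInvariants g h)
    (D : MvPolynomial (Fin (n + 1)) ℚ)
    (hD : IsDXJ g h D) :
    ∃ V : Set (Fin n → ℂ), IsAffineVariety V ∧ Vᶜ.Nonempty ∧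
      ∀ (K : Type) [Field K] [CharZero K] [Algebra K ℂ] (a : Fin n → K),
        (fun i => algebraMap K ℂ (a i)) ∉ V →
          (elimIdeal g h a).radical = Ideal.span {MvPolynomial.aeval (sample a) D} := by
  obtain ⟨c, hc, H⟩ := Elimination.exists_radical_elimIdeal_eq hD
  refine ⟨zeroLocus ℂ (Ideal.span {c}), ⟨_, rfl⟩, ?_, fun K _ _ _ a ha => H K a fun hca => ha ?_⟩
  · by_contra hne
    rw [Set.not_nonempty_iff_eq_empty, Set.compl_empty_iff] at hne
    -- A polynomial vanishing on all of `ℂⁿ` lies in the vanishing ideal of the zero locus of `⊥`,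
    -- which is `⊥`.
    have hmem : c ∈ vanishingIdeal ℚ (zeroLocus ℂ (⊥ : Ideal (MvPolynomial (Fin n) ℚ))) := by
      rw [zeroLocus_bot, Set.top_eq_univ, ← hne]
      exact le_vanishingIdeal_zeroLocus _ (Ideal.mem_span_singleton_self c)
    rw [IsPrime.vanishingIdeal_zeroLocus] at hmem
    exact hc hmem
  · rw [zeroLocus_span]
    have hmap : aeval (fun i => algebraMap K ℂ (a i)) c = algebraMap K ℂ (aeval a c) :=
      aeval_algebraMap_apply ℂ a c
    simp [hmap, hca]
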